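/- Let $G$ be a group generated as a monoid by a finite set $S$, where each $s\in S$ has a weight $\omega(s)\in\{1,2,3,\ldots\}$. For a word $\sigma=\sigma_1\cdots\sigma_q\in S^*$ let $|\sigma|_S=q$ be its length, $\overline{\sigma}\in G$ the element that it represents and $\omega(\sigma)=\sum_i\omega(\sigma_i)$ its weight; $\sigma$ is a geodesic if no word in $S^*$ representing $\overline\sigma$ has smaller weight. Let $N\trianglelefteq G$ be a normal subgroup of finite index $d$ that is isomorphic to $\mathbb{Z}^n$ for some $n\ge 0$ (so $G$ is virtually abelian), and let $T\ni 1$ be a set of coset representatives for $N$ in $G$; every $g\in G$ is uniquely $g=z\cdot\rho(g)$ with $z\in N$ and $\rho(g)\in T$. Put $$Y=\{\sigma\in S^*\mid 1\le|\sigma|_S\le d,\ \overline\sigma\in N\},\qquad P=\{\sigma\in S^*\mid 1\le|\sigma|_S\le d-1,\ \overline\sigma\notin N\},$$ and fix a labelling $Y=\{y_1,\ldots,y_m\}$ with $m=|Y|$. A pattern is a word $\pi=\pi_1\pi_2\cdots\pi_k\in P^*$ in the letters of $P$, with $0\le k\le d$, such that $\rho(\overline{\pi_1\cdots\pi_i})$,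 $0\le i\le k-1$, are pairwise distinct. For $v\in\mathbb{N}^{(k+1)m}$ (where $0\in\mathbb{N}$) the patterned word $v^\pi\in S^*$ is $$v^\pi=\big(y_1^{v_1}\cdots y_m^{v_m}\big)\,\pi_1\,\big(y_1^{v_{m+1}}\cdots y_m^{v_{2m}}\big)\,\pi_2\cdots\pi_k\,\big(y_1^{v_{km+1}}\cdots y_m^{v_{(k+1)m}}\big).$$ An elementary region of $\mathbb{Z}^r$ is a set of the form $\{z\mid a\cdot z=b\}$, $\{z\mid a\cdot z>b\}$ or $\{z\mid a\cdot z\equiv b\ (\mathrm{mod}\ c)\}$ with $a\in\mathbb{Z}^r$, $b,c\in\mathbb{Z}$, $c>0$; a basic polyhedral set is a finite intersection of elementary regions, and a polyhedral set is a finite disjoint union of basic polyhedral sets. Lemma. For each pattern $\pi=\pi_1\cdots\pi_k$ there is a polyhedral set $\mathcal{G}_\pi\subseteq\mathbb{Z}^{(k+1)m}$ with $\mathcal{G}_\pi\subseteq\mathbb{N}^{(k+1)m}$ such that, for each $v\in\mathbb{N}^{(k+1)m}$, we have $v\in\mathcal{G}_\pi$ if and only if the word $v^\pi$ is a geodesic.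 -/

import Mathlib

namespace VirtAb

section Polyhedral

/-- An elementary region of `ℤ^r`: the solution set of one equation, strict inequality or
congruence with integer coefficients. -/
def IsElementaryRegion {r : ℕ} (E : Set (Fin r → ℤ)) : Prop :=
  ∃ (a : Fin r → ℤ) (b : ℤ),
    E = {z | a ⬝ᵥ z = b} ∨ E = {z | a ⬝ᵥ z > b} ∨
      ∃ c : ℤ, 0 < c ∧ E = {z | a ⬝ᵥ z ≡ b [ZMOD c]}

/-- A basic polyhedral set: a finite intersection of elementary regions. -/
def IsBasicPolyhedral {r : ℕ} (B : Set (Fin r → ℤ)) : Prop :=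
  ∃ F : Set (Set (Fin r → ℤ)), F.Finite ∧ (∀ E ∈ F, IsElementaryRegion E) ∧ B = ⋂₀ F

/-- A polyhedral set: a finite disjoint union of basic polyhedral sets. -/
def IsPolyhedral {r : ℕ} (Q : Set (Fin r → ℤ)) : Prop :=
  ∃ F : Set (Set (Fin r → ℤ)),
    F.Finite ∧ (∀ B ∈ F, IsBasicPolyhedral B) ∧ F.PairwiseDisjoint id ∧ Q = ⋃₀ F

/-- The subset `ℕ^r` of `ℤ^r`. -/
def natVectors (r : ℕ) : Set (Fin r → ℤ) := {z | ∀ i, 0 ≤ z i}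

end Polyhedral

section Words

variable {G : Type*} [Group G] {S : Set G}

/-- The group element represented by a word in the letters of `S`. -/
def eval (σ : List S) : G := (σ.map Subtype.val).prod

/-- The weight of a word. -/
def weight (ω : S → ℕ) (σ : List S) : ℕ := (σ.map ω).sum

/-- The weighted length of a group element: the least weight of a word representing it. -/
noncomputable def weightedLength (ω : S → ℕ) (g : G) : ℕ :=
  sInf {k | ∃ σ : List S, eval σ = g ∧ weight ω σ = k}

/-- A word is a geodesic if it represents its group element with minimal weight. -/
def IsGeodesic (ω : S → ℕ) (σ : List S) : Prop :=
  weight ω σ = weightedLength ω (eval σ)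

end Words

section Patterns

variable {G : Type*} [Group G]

/-- The representative `t ∈ T` in the normal form `g = z * t` with `z ∈ N` and `t ∈ T`. -/
noncomputable def rho {N : Subgroup G} {T : Set G}
    (hT : Subgroup.IsComplement (N : Set G) T) (g : G) : T :=
  (hT.equiv g).2

/-- The set `Y` of words of length between `1` and `[G : N]` representing an element of `N`. -/
def wordsY (S : Set G) (N : Subgroup G) : Set (List S) :=
  {σ | 1 ≤ σ.length ∧ σ.length ≤ N.index ∧ eval σ ∈ N}

/-- The set `P` of words of length between `1` and `[G : N] - 1` representing an element
outside `N`. -/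
def wordsP (S : Set G) (N : Subgroup G) : Set (List S) :=
  {σ | 1 ≤ σ.length ∧ σ.length ≤ N.index - 1 ∧ eval σ ∉ N}

/-- The word in the letters of `S` spelled by a word in the letters of `P`. -/
def spell {S : Set G} {N : Subgroup G} (π : List (wordsP S N)) : List S :=
  (π.map Subtype.val).flatten

/-- Patterns: words of length at most `[G : N]` in the letters of `P` whose proper prefixes lie
in pairwise distinct cosets. -/
def IsPattern {S : Set G} {N : Subgroup G} {T : Set G}
    (hT : Subgroup.IsComplement (N : Set G) T) (π : List (wordsP S N)) : Prop :=
  π.length ≤ N.index ∧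
    ∀ i < π.length, ∀ j < π.length,
      rho hT (eval (spell (π.take i))) = rho hT (eval (spell (π.take j))) → i = j

/-- The word `y₁ ^ u₁ ⋯ yₘ ^ uₘ`. -/
def powerWord {S : Set G} {N : Subgroup G} {m : ℕ} (y : Fin m ≃ wordsY S N)
    (u : Fin m → ℕ) : List S :=
  (List.ofFn fun i => (List.replicate (u i) (y i : List S)).flatten).flatten

/-- The `j`-th block `(v_{jm+1}, …, v_{jm+m})`, for `0 ≤ j ≤ k`, of a vector
`v ∈ ℕ^{(k+1)m}`. -/
def block {k m : ℕ} (v : Fin ((k + 1) * m) → ℕ) (j : Fin (k + 1)) : Fin m → ℕ :=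
  fun i => v (finProdFinEquiv (j, i))

/-- The word `v ^ π`: the power words of the successive blocks of `v`, separated by the letters
of `π`. -/
def patternedWord {S : Set G} {N : Subgroup G} {m : ℕ} (y : Fin m ≃ wordsY S N)
    (π : List (wordsP S N)) (v : Fin ((π.length + 1) * m) → ℕ) : List S :=
  powerWord y (block v 0) ++
    (List.ofFn fun j : Fin π.length =>
      (π.get j : List S) ++ powerWord y (block v j.succ)).flatten

end Patterns

end VirtAb

/-!
Work in `H = G × ℤ`, with the weight of a word as second coordinate. The pairs `(g, k)` such that
some word of weight at most `k` represents `g` form the submonoid of `H` generated by the letters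
with their weights and by `(1, 1)`, and a word is a geodesic if and only if its pair, lowered by
one, lies outside this finitely generated submonoid.

The abelian normal subgroup `M = N × ℤ` has finite index in `H`. A long word over a finite subset
of `H` contains a short loop (a factor with value in `M`) that can be deleted without losing a
visited coset of `M`, and a loop inserted at any visited coset multiplies the value of the word by
an element of `M` that depends on the loop and that coset only. Hence a finitely generated
submonoid of `H` is a finite union of translates of finitely generated submonoids of `M`. On the
other hand, the pair of `v ^ π` is, as a function of `v`, a homomorphism into `M` followed by a
right translation. So the `v` for which `v ^ π` is not a geodesic form a semilinear subset of
`ℕ^r`. Semilinear sets are closed under complements, and in `ℤ^r` they are polyhedral.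
-/

namespace VirtAb

section Polyhedral

open Matrix

section Boolean

variable {r : ℕ} {A B : Set (Fin r → ℤ)}

theorem IsElementaryRegion.isBasicPolyhedral (hA : IsElementaryRegion A) : IsBasicPolyhedral A :=
  ⟨{A}, Set.finite_singleton A, by simpa using hA, Set.sInter_singleton A |>.symm⟩

theorem IsBasicPolyhedral.univ : IsBasicPolyhedral (Set.univ : Set (Fin r → ℤ)) :=
  ⟨∅, Set.finite_empty, by simp, Set.sInter_empty.symm⟩

theorem IsBasicPolyhedral.inter (hA : IsBasicPolyhedral A) (hB : IsBasicPolyhedral B) :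
    IsBasicPolyhedral (A ∩ B) := by
  obtain ⟨F, hF, hFE, rfl⟩ := hA
  obtain ⟨F', hF', hFE', rfl⟩ := hB
  exact ⟨F ∪ F', hF.union hF', fun E hE => hE.elim (hFE E) (hFE' E), (Set.sInter_union _ _).symm⟩

theorem IsBasicPolyhedral.iInter {ι : Type*} [Finite ι] {s : ι → Set (Fin r → ℤ)}
    (hs : ∀ i, IsBasicPolyhedral (s i)) : IsBasicPolyhedral (⋂ i, s i) := by
  choose F hF hFE hsF using hs
  refine ⟨⋃ i, F i, Set.finite_iUnion hF, fun E hE => ?_, ?_⟩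
  · obtain ⟨i, hi⟩ := Set.mem_iUnion.1 hE
    exact hFE i E hi
  · rw [Set.sInter_iUnion, Set.iInter_congr hsF]

theorem IsBasicPolyhedral.isPolyhedral (hA : IsBasicPolyhedral A) : IsPolyhedral A :=
  ⟨{A}, Set.finite_singleton A, by simpa using hA, Set.pairwiseDisjoint_singleton A id,
    Set.sUnion_singleton A |>.symm⟩

theorem IsPolyhedral.empty : IsPolyhedral (∅ : Set (Fin r → ℤ)) :=
  ⟨∅, Set.finite_empty, by simp, Set.pairwiseDisjoint_empty, Set.sUnion_empty.symm⟩

theorem IsPolyhedral.disjoint_union (hA : IsPolyhedral A) (hB : IsPolyhedral B)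
    (hAB : Disjoint A B) : IsPolyhedral (A ∪ B) := by
  obtain ⟨F, hF, hFP, hFd, rfl⟩ := hA
  obtain ⟨F', hF', hFP', hFd', rfl⟩ := hB
  refine ⟨F ∪ F', hF.union hF', fun P hP => hP.elim (hFP P) (hFP' P), ?_,
    (Set.sUnion_union _ _).symm⟩
  exact Set.pairwiseDisjoint_union.2 ⟨hFd, hFd', fun P hP P' hP' _ =>
    hAB.mono (Set.subset_sUnion_of_mem hP) (Set.subset_sUnion_of_mem hP')⟩

theorem IsPolyhedral.inter (hA : IsPolyhedral A) (hB : IsPolyhedral B) :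
    IsPolyhedral (A ∩ B) := by
  obtain ⟨F, hF, hFP, hFd, rfl⟩ := hA
  obtain ⟨F', hF', hFP', hFd', rfl⟩ := hB
  refine ⟨Set.image2 (· ∩ ·) F F', hF.image2 _ hF', ?_, ?_, ?_⟩
  · rintro _ ⟨P, hP, P', hP', rfl⟩
    exact (hFP P hP).inter (hFP' P' hP')
  · rintro _ ⟨P, hP, P', hP', rfl⟩ _ ⟨Q, hQ, Q', hQ', rfl⟩ hne
    by_cases h : P = Q
    · have h' : P' ≠ Q' := by rintro rfl; exact hne (h ▸ rfl)
      exact (hFd' hP' hQ' h').mono Set.inter_subset_right Set.inter_subset_right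
    · exact (hFd hP hQ h).mono Set.inter_subset_left Set.inter_subset_left
  · rw [Set.sUnion_inter_sUnion, ← Set.image_prod, Set.sUnion_image]

theorem isBasicPolyhedral_eq (a : Fin r → ℤ) (b : ℤ) : IsBasicPolyhedral {z | a ⬝ᵥ z = b} :=
  IsElementaryRegion.isBasicPolyhedral ⟨a, b, .inl rfl⟩

theorem isBasicPolyhedral_modEq (a : Fin r → ℤ) (b : ℤ) {c : ℤ} (hc : 0 < c) :
    IsBasicPolyhedral {z | a ⬝ᵥ z ≡ b [ZMOD c]} :=
  IsElementaryRegion.isBasicPolyhedral ⟨a, b, .inr (.inr ⟨c, hc, rfl⟩)⟩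

theorem isBasicPolyhedral_ge (a : Fin r → ℤ) (b : ℤ) : IsBasicPolyhedral {z | b ≤ a ⬝ᵥ z} :=
  IsElementaryRegion.isBasicPolyhedral ⟨a, b - 1, .inr (.inl (by simp))⟩

theorem isBasicPolyhedral_le (a : Fin r → ℤ) (b : ℤ) : IsBasicPolyhedral {z | a ⬝ᵥ z ≤ b} := by
  simpa using isBasicPolyhedral_ge (-a) (-b)

theorem isPolyhedral_compl_modEq (a : Fin r → ℤ) (b : ℤ) {c : ℤ} (hc : 0 < c) :
    IsPolyhedral {z | a ⬝ᵥ z ≡ b [ZMOD c]}ᶜ := by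
  refine ⟨(fun i => {z | a ⬝ᵥ z % c = i}) '' (Set.Ico 0 c \ {b % c}),
    (Set.finite_Ico 0 c).sdiff.image _, ?_, ?_, ?_⟩
  · rintro _ ⟨i, ⟨hi, -⟩, rfl⟩
    convert isBasicPolyhedral_modEq a i hc using 3 with z
    rw [Int.ModEq, Int.emod_eq_of_lt hi.1 hi.2]
  · rintro _ ⟨i, -, rfl⟩ _ ⟨j, -, rfl⟩ hne
    refine Set.disjoint_left.2 fun z hi hj => hne ?_
    rw [← show a ⬝ᵥ z % c = i from hi, ← show a ⬝ᵥ z % c = j from hj]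
  · ext z
    simp [Int.ModEq, Int.emod_nonneg _ hc.ne', Int.emod_lt_of_pos _ hc]

theorem IsElementaryRegion.isPolyhedral_compl (hA : IsElementaryRegion A) :
    IsPolyhedral Aᶜ := by
  obtain ⟨a, b, rfl | rfl | ⟨c, hc, rfl⟩⟩ := hA
  · have hne : {z | a ⬝ᵥ z = b}ᶜ = {z | b + 1 ≤ a ⬝ᵥ z} ∪ {z | a ⬝ᵥ z ≤ b - 1} := by
      ext z
      simp only [Set.mem_compl_iff, Set.mem_ofPred_eq, Set.mem_union]
      omega
    rw [hne]
    refine (isBasicPolyhedral_ge a _).isPolyhedral.disjoint_union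
      (isBasicPolyhedral_le a _).isPolyhedral (Set.disjoint_left.2 fun z => ?_)
    simp only [Set.mem_ofPred_eq]
    omega
  · simpa only [Set.compl_ofPred, gt_iff_lt, not_lt] using (isBasicPolyhedral_le a b).isPolyhedral
  · exact isPolyhedral_compl_modEq a b hc

theorem IsBasicPolyhedral.isPolyhedral_compl (hA : IsBasicPolyhedral A) : IsPolyhedral Aᶜ := by
  obtain ⟨F, hF, hFE, rfl⟩ := hA
  induction F, hF using Set.Finite.induction_on with
  | empty => simpa only [Set.sInter_empty, Set.compl_univ] using IsPolyhedral.empty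
  | @insert E F _ _ ih =>
    rw [Set.forall_mem_insert] at hFE
    have hcompl : (⋂₀ insert E F)ᶜ = Eᶜ ∪ (E ∩ (⋂₀ F)ᶜ) := by
      rw [Set.sInter_insert, Set.compl_inter, Set.union_inter_distrib_left, Set.compl_union_self,
        Set.univ_inter]
    rw [hcompl]
    exact hFE.1.isPolyhedral_compl.disjoint_union
      (hFE.1.isBasicPolyhedral.isPolyhedral.inter (ih hFE.2))
      (disjoint_compl_left.mono_right Set.inter_subset_left)

theorem IsPolyhedral.compl (hA : IsPolyhedral A) : IsPolyhedral Aᶜ := by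
  obtain ⟨F, hF, hFP, -, rfl⟩ := hA
  induction F, hF using Set.Finite.induction_on with
  | empty =>
    simpa only [Set.sUnion_empty, Set.compl_empty] using IsBasicPolyhedral.univ.isPolyhedral
  | insert _ _ ih =>
    rw [Set.forall_mem_insert] at hFP
    rw [Set.sUnion_insert, Set.compl_union]
    exact hFP.1.isPolyhedral_compl.inter (ih hFP.2)

theorem IsPolyhedral.union (hA : IsPolyhedral A) (hB : IsPolyhedral B) :
    IsPolyhedral (A ∪ B) := by
  simpa only [Set.compl_inter, compl_compl] using (hA.compl.inter hB.compl).compl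

theorem IsPolyhedral.sUnion {F : Set (Set (Fin r → ℤ))} (hF : F.Finite)
    (hFP : ∀ P ∈ F, IsPolyhedral P) : IsPolyhedral (⋃₀ F) := by
  induction F, hF using Set.Finite.induction_on with
  | empty => simpa only [Set.sUnion_empty] using IsPolyhedral.empty
  | insert _ _ ih =>
    rw [Set.forall_mem_insert] at hFP
    rw [Set.sUnion_insert]
    exact hFP.1.union (ih hFP.2)

end Boolean

section Semilinear

theorem exists_mul_eq_smul_one {m n R : Type*} [Fintype m] [Fintype n] [DecidableEq n]
    [CommRing R] [LinearOrder R] [IsStrictOrderedRing R] {A : Matrix m n R}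
    (hA : Function.Injective A.mulVec) :
    ∃ (L : Matrix n m R) (D : R), 0 < D ∧ L * A = D • 1 := by
  have hdet : (Aᵀ * A).det ≠ 0 := by
    intro h
    obtain ⟨v, hv, hker⟩ := exists_mulVec_eq_zero_iff.2 h
    refine hv (hA ?_)
    rw [mulVec_zero, ← dotProduct_self_eq_zero, dotProduct_mulVec, ← mulVec_transpose,
      mulVec_mulVec, hker, zero_dotProduct]
  -- The extra factor `det` turns the scalar into a square, hence makes it positive.
  refine ⟨(Aᵀ * A).det • ((Aᵀ * A).adjugate * Aᵀ), (Aᵀ * A).det * (Aᵀ * A).det,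
    mul_self_pos.2 hdet, ?_⟩
  rw [smul_mul, Matrix.mul_assoc, adjugate_mul, smul_smul]

theorem exists_mulVec_natCast_eq_iff {m n : Type*} [Fintype m] [Fintype n] [DecidableEq m]
    [DecidableEq n] {A : Matrix m n ℤ} {L : Matrix n m ℤ} {D : ℤ} (hD : 0 < D)
    (hLA : L * A = D • 1) (w : m → ℤ) :
    (∃ c : n → ℕ, A *ᵥ (fun j => (c j : ℤ)) = w) ↔
      (∀ j, 0 ≤ L j ⬝ᵥ w) ∧ (∀ j, L j ⬝ᵥ w ≡ 0 [ZMOD D]) ∧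
        ∀ i, (A * L - D • 1 : Matrix _ _ ℤ) i ⬝ᵥ w = 0 := by
  have hker : (∀ i, (A * L - D • 1 : Matrix _ _ ℤ) i ⬝ᵥ w = 0) ↔ A *ᵥ (L *ᵥ w) = D • w := by
    rw [mulVec_mulVec, ← sub_eq_zero, ← one_mulVec (D • w), mulVec_smul, ← smul_mulVec,
      ← sub_mulVec, funext_iff]
    rfl
  rw [hker]
  constructor
  · rintro ⟨c, rfl⟩
    have hL : L *ᵥ (A *ᵥ fun j => (c j : ℤ)) = D • fun j => (c j : ℤ) := by
      rw [mulVec_mulVec, hLA, smul_mulVec, one_mulVec]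
    have hLj (j : n) : L j ⬝ᵥ (A *ᵥ fun j => (c j : ℤ)) = D * c j := congrFun hL j
    refine ⟨fun j => ?_, fun j => ?_, by rw [hL, mulVec_smul]⟩
    · rw [hLj]
      positivity
    · rw [hLj]
      exact Int.modEq_zero_iff_dvd.2 (dvd_mul_right _ _)
  · rintro ⟨hnonneg, hmod, hw⟩
    choose c hc using fun j => Int.modEq_zero_iff_dvd.1 (hmod j)
    have hcnonneg (j : n) : 0 ≤ c j := nonneg_of_mul_nonneg_right (hc j ▸ hnonneg j) hD
    have hLw : L *ᵥ w = D • c := funext hc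
    lift c to n → ℕ using hcnonneg
    rw [hLw, mulVec_smul] at hw
    exact ⟨c, smul_right_injective _ hD.ne' hw⟩

theorem isBasicPolyhedral_range_mulVec_natCast {r : ℕ} {n : Type*} [Fintype n]
    {A : Matrix (Fin r) n ℤ} (hA : Function.Injective A.mulVec) :
    IsBasicPolyhedral (Set.range fun c : n → ℕ => A *ᵥ (fun j => (c j : ℤ))) := by
  classical
  obtain ⟨L, D, hD, hLA⟩ := exists_mul_eq_smul_one hA
  have hrange : (Set.range fun c : n → ℕ => A *ᵥ (fun j => (c j : ℤ))) =
      (⋂ j, {w | 0 ≤ L j ⬝ᵥ w}) ∩ ((⋂ j, {w | L j ⬝ᵥ w ≡ 0 [ZMOD D]}) ∩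
        ⋂ i, {w | (A * L - D • 1 : Matrix _ _ ℤ) i ⬝ᵥ w = 0}) := by
    ext w
    simp only [Set.mem_inter_iff, Set.mem_iInter]
    exact exists_mulVec_natCast_eq_iff hD hLA w
  rw [hrange]
  exact (IsBasicPolyhedral.iInter fun _ => isBasicPolyhedral_ge _ _).inter
    ((IsBasicPolyhedral.iInter fun _ => isBasicPolyhedral_modEq _ _ hD).inter
      (.iInter fun _ => isBasicPolyhedral_eq _ _))

variable {r : ℕ} {s : Set (Fin r → ℤ)}

open scoped Pointwise

theorem IsElementaryRegion.vadd (hs : IsElementaryRegion s) (u : Fin r → ℤ) :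
    IsElementaryRegion (u +ᵥ s) := by
  obtain ⟨a, b, rfl | rfl | ⟨c, hc, rfl⟩⟩ := hs
  · refine ⟨a, a ⬝ᵥ u + b, .inl (Set.ext fun z => ?_)⟩
    simp [Set.mem_vadd_set_iff_neg_vadd_mem, dotProduct_add, neg_add_eq_iff_eq_add]
  · refine ⟨a, a ⬝ᵥ u + b, .inr (.inl (Set.ext fun z => ?_))⟩
    simp [Set.mem_vadd_set_iff_neg_vadd_mem, dotProduct_add, lt_neg_add_iff_add_lt]
  · refine ⟨a, a ⬝ᵥ u + b, .inr (.inr ⟨c, hc, Set.ext fun z => ?_⟩)⟩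
    simp only [Set.mem_vadd_set_iff_neg_vadd_mem, vadd_eq_add, Set.mem_ofPred_eq, dotProduct_add,
      dotProduct_neg, Int.modEq_iff_dvd]
    rw [show a ⬝ᵥ u + b - a ⬝ᵥ z = b - (-(a ⬝ᵥ u) + a ⬝ᵥ z) by ring]

theorem IsBasicPolyhedral.vadd (hs : IsBasicPolyhedral s) (u : Fin r → ℤ) :
    IsBasicPolyhedral (u +ᵥ s) := by
  obtain ⟨F, hF, hFE, rfl⟩ := hs
  refine ⟨(u +ᵥ ·) '' F, hF.image _, ?_, ?_⟩
  · rintro _ ⟨E, hE, rfl⟩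
    exact (hFE E hE).vadd u
  · rw [Set.sInter_image, Set.sInter_eq_biInter]
    exact Set.image_iInter₂ (AddAction.bijective u) _

theorem linearIndependent_int_of_nat {ι V : Type*} [AddCommGroup V] {v : ι → V}
    (hv : LinearIndependent ℕ v) : LinearIndependent ℤ v := by
  refine linearIndependent_iff'.2 fun t c hc i hi => ?_
  have hparts : ∑ j ∈ t, (c j).toNat • v j = ∑ j ∈ t, (-c j).toNat • v j := by
    rw [← sub_eq_zero, ← Finset.sum_sub_distrib, ← hc]
    refine Finset.sum_congr rfl fun j _ => ?_
    rw [← natCast_zsmul, ← natCast_zsmul, ← sub_smul, Int.toNat_sub_toNat_neg]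
  have := linearIndependent_iff'ₛ.1 hv t _ _ hparts i hi
  omega

theorem isBasicPolyhedral_of_isProperLinearSet (hs : IsProperLinearSet s) :
    IsBasicPolyhedral s := by
  rw [isProperLinearSet_iff] at hs
  obtain ⟨u, t, ht, rfl⟩ := hs
  set A : Matrix (Fin r) t ℤ := Matrix.of fun i p => (p : Fin r → ℤ) i
  have hA (c : t → ℤ) : A *ᵥ c = ∑ p : t, c p • (p : Fin r → ℤ) := by
    ext i
    simp [A, mulVec, dotProduct, mul_comm]
  have hinj : Function.Injective A.mulVec :=
    mulVec_injective_iff.2 (linearIndependent_int_of_nat ht)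
  have hrange : (AddSubmonoid.closure (t : Set (Fin r → ℤ)) : Set (Fin r → ℤ)) =
      Set.range fun c : t → ℕ => A *ᵥ (fun p => (c p : ℤ)) := by
    ext w
    simp [AddSubmonoid.mem_closure_iff_of_fintype, hA, eq_comm]
  rw [hrange]
  exact (isBasicPolyhedral_range_mulVec_natCast hinj).vadd u

theorem isPolyhedral_of_isSemilinearSet (hs : IsSemilinearSet s) : IsPolyhedral s := by
  obtain ⟨F, hF, hFL, rfl⟩ := hs.isProperSemilinearSet
  exact .sUnion hF fun P hP => (isBasicPolyhedral_of_isProperLinearSet (hFL P hP)).isPolyhedral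

theorem exists_isPolyhedral_natCast_mem_iff {s : Set (Fin r → ℕ)} (hs : IsSemilinearSet s) :
    ∃ Q : Set (Fin r → ℤ), IsPolyhedral Q ∧ Q ⊆ natVectors r ∧
      ∀ v : Fin r → ℕ, (fun i => (v i : ℤ)) ∈ Q ↔ v ∈ s := by
  let cast : (Fin r → ℕ) →+ (Fin r → ℤ) := (Nat.castAddMonoidHom ℤ).compLeft _
  have hcast : Function.Injective cast := (Nat.cast_injective (R := ℤ)).comp_left
  refine ⟨cast '' s, isPolyhedral_of_isSemilinearSet (hs.image cast), ?_,
    fun v => hcast.mem_set_image⟩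
  rintro _ ⟨v, -, rfl⟩ i
  exact Int.natCast_nonneg (v i)

end Semilinear

end Polyhedral

section VirtuallyAbelian

open scoped IsMulCommutative Pointwise

/-- The words of length at most `n` in the letters of `A`. -/
def boundedWords {H : Type*} (A : Set H) (n : ℕ) : Set (List H) :=
  {σ | (∀ x ∈ σ, x ∈ A) ∧ σ.length ≤ n}

theorem finite_boundedWords {H : Type*} {A : Set H} (hA : A.Finite) (n : ℕ) :
    (boundedWords A n).Finite := by
  have : Finite A := hA
  refine ((List.finite_length_le A n).image (List.map (↑))).subset fun σ hσ => ?_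
  lift σ to List A using hσ.1
  exact ⟨σ, by simpa using hσ.2, rfl⟩

variable {H : Type*} [Group H] {M : Subgroup H} [M.Normal]

variable (M) in
/-- The cosets of `M` through which a word passes, that is, the cosets of its prefixes. -/
def visitedCosets (σ : List H) : Set (H ⧸ M) :=
  Set.range fun i => ((σ.take i).prod : H ⧸ M)

theorem visitedCosets_append (p q : List H) :
    visitedCosets M (p ++ q) = visitedCosets M p ∪ (p.prod : H ⧸ M) • visitedCosets M q := by
  ext c
  constructor
  · rintro ⟨i, rfl⟩
    rcases le_total i p.length with hi | hi
    · exact .inl ⟨i, by simp only [List.take_append_of_le_length hi]⟩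
    · refine .inr ⟨_, ⟨i - p.length, rfl⟩, ?_⟩
      simp [List.take_append, List.take_of_length_le hi]
  · rintro (⟨i, rfl⟩ | ⟨_, ⟨i, rfl⟩, rfl⟩)
    · exact ⟨min i p.length, by simp [List.take_append, ← List.take_take]⟩
    · exact ⟨p.length + i, by simp [List.take_length_add_append]⟩

theorem visitedCosets_append_left_subset (p q : List H) :
    visitedCosets M p ⊆ visitedCosets M (p ++ q) :=
  (visitedCosets_append (M := M) p q).symm ▸ Set.subset_union_left

theorem monotone_visitedCosets_take (σ : List H) :
    Monotone fun i => visitedCosets M (σ.take i) := by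
  refine monotone_nat_of_le_succ fun i => ?_
  rw [List.take_add]
  exact visitedCosets_append_left_subset _ _

theorem visitedCosets_append_loop {p l : List H} (hl : l.prod ∈ M) (q : List H) :
    visitedCosets M (p ++ l ++ q) =
      visitedCosets M (p ++ l) ∪ (p.prod : H ⧸ M) • visitedCosets M q := by
  rw [visitedCosets_append, List.prod_append, QuotientGroup.mk_mul_of_mem _ hl]

theorem exists_subset_succ_of_monotone {Q : Type*} [Finite Q] {s : ℕ → Set Q} (hs : Monotone s)
    (h₀ : (s 0).Nonempty) : ∃ a < Nat.card Q, s (a + 1) ⊆ s a := by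
  by_contra! h
  have hcard : ∀ a ≤ Nat.card Q, a < (s a).ncard := by
    intro a
    induction a with
    | zero => exact fun _ => (Set.ncard_pos (Set.toFinite _)).2 h₀
    | succ a ih =>
      intro ha
      exact (Nat.succ_le_of_lt (ih (Nat.le_of_succ_le ha))).trans_lt
        (Set.ncard_lt_ncard ⟨hs a.le_succ, h a ha⟩ (Set.toFinite _))
  exact (hcard _ le_rfl).not_ge (Set.ncard_le_card _)

/-- Split the word into `[H : M]` stretches of `[H : M]` letters. Some stretch visits no new
coset, and by the pigeonhole principle it contains a loop. -/
theorem exists_redundant_loop [M.FiniteIndex] {σ : List H} (hσ : M.index * M.index ≤ σ.length) :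
    ∃ p l q, σ = p ++ l ++ q ∧ l ≠ [] ∧ l.length ≤ M.index ∧ l.prod ∈ M ∧
      visitedCosets M (p ++ l) ⊆ visitedCosets M p := by
  set d := M.index
  have hmono := monotone_visitedCosets_take (M := M) σ
  obtain ⟨a, ha, hstay⟩ := exists_subset_succ_of_monotone
    (hmono.comp (monotone_mul_right_of_nonneg d.zero_le)) (Set.range_nonempty _)
  obtain ⟨i, j, hij, hcoset⟩ : ∃ i j : Fin (d + 1), i < j ∧
      ((σ.take (a * d + i)).prod : H ⧸ M) = (σ.take (a * d + j)).prod := by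
    by_contra! hne
    have := Nat.card_le_card_of_injective _ (.of_lt_imp_ne hne)
    rw [Nat.card_fin] at this
    exact this.not_gt d.lt_succ_self
  obtain ⟨n, hn⟩ := Nat.exists_eq_add_of_lt hij
  have hj : a * d + j = a * d + i + (n + 1) := by omega
  have hend : a * d + j ≤ (a + 1) * d := by rw [add_one_mul]; omega
  have hlen : a * d + j ≤ σ.length := hend.trans ((Nat.mul_le_mul_right d ha).trans hσ)
  have htake : σ.take (a * d + j) = σ.take (a * d + i) ++ (σ.drop (a * d + i)).take (n + 1) := by
    rw [hj, List.take_add]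
  refine ⟨σ.take (a * d + i), (σ.drop (a * d + i)).take (n + 1), σ.drop (a * d + j), ?_, ?_, ?_,
    ?_, ?_⟩
  · rw [← htake, List.take_append_drop]
  · rw [← List.length_pos_iff, List.length_take, List.length_drop]
    omega
  · rw [List.length_take]
    omega
  · rw [htake, List.prod_append, QuotientGroup.mk_mul, left_eq_mul] at hcoset
    exact (QuotientGroup.eq_one_iff _).1 hcoset
  · rw [← htake]
    exact (hmono hend).trans (hstay.trans (hmono (Nat.le_add_right _ _)))

variable [IsMulCommutative M]

variable (M) in
/-- The action of `H ⧸ M` on the abelian normal subgroup `M` by conjugation. -/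
def cosetConj : H ⧸ M →* MulAut M :=
  QuotientGroup.lift M MulAut.conjNormal fun g hg => by
    ext z
    have hcomm : g * z = z * g := congrArg Subtype.val (mul_comm' ⟨g, hg⟩ z)
    simp [hcomm]

theorem cosetConj_mul (g : H) (z : M) : (cosetConj M g z : H) * g = g * z := by
  change (MulAut.conjNormal g z : H) * g = g * z
  rw [MulAut.conjNormal_apply, inv_mul_cancel_right]

/-- For a set `V` of cosets, the submonoid of `M` generated by the loops of at most `[H : M]`
letters inserted at points of a word that lie in `V`. -/
def loopSubmonoid (A : Set H) (V : Set (H ⧸ M)) : Submonoid M :=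
  .closure (Set.image2 (cosetConj M ·) V ((↑) ⁻¹' (List.prod '' boundedWords A M.index)))

theorem fg_loopSubmonoid [M.FiniteIndex] {A : Set H} (hA : A.Finite) (V : Set (H ⧸ M)) :
    (loopSubmonoid A V).FG :=
  (Submonoid.fg_iff _).2 ⟨_, rfl, (Set.toFinite V).image2 _
    (((finite_boundedWords hA _).image _).preimage Subtype.coe_injective.injOn)⟩

theorem cosetConj_mem_loopSubmonoid {A : Set H} {V : Set (H ⧸ M)} {c : H ⧸ M} (hc : c ∈ V)
    {l : List H} (hl : l ∈ boundedWords A M.index) (hlM : l.prod ∈ M) :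
    cosetConj M c ⟨l.prod, hlM⟩ ∈ loopSubmonoid A V :=
  Submonoid.subset_closure ⟨c, hc, _, ⟨l, hl, rfl⟩, rfl⟩

theorem prod_insert_loop (p q : List H) {l : List H} (hl : l.prod ∈ M) :
    (p ++ l ++ q).prod = cosetConj M p.prod ⟨l.prod, hl⟩ * (p ++ q).prod := by
  simp only [List.prod_append, ← mul_assoc, cosetConj_mul]

/-- Deleting loops without losing a visited coset brings every word down to bounded length. -/
theorem exists_prod_eq_loop_mul_prod [M.FiniteIndex] {A : Set H} (σ : List H)
    (hσ : ∀ x ∈ σ, x ∈ A) :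
    ∃ β ∈ boundedWords A (M.index * M.index), visitedCosets M σ ⊆ visitedCosets M β ∧
      ∃ z ∈ loopSubmonoid A (visitedCosets M β), σ.prod = z * β.prod := by
  induction h : σ.length using Nat.strong_induction_on generalizing σ with | _ n ih
  subst h
  rcases le_total σ.length (M.index * M.index) with hshort | hlong
  · exact ⟨σ, ⟨hσ, hshort⟩, subset_rfl, 1, one_mem _, by simp⟩
  obtain ⟨p, l, q, rfl, hl, hlen, hlM, hvisit⟩ := exists_redundant_loop hlong
  simp only [List.forall_mem_append] at hσ
  obtain ⟨β, hβ, hsub, z, hz, hprod⟩ := ih (p ++ q).length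
    (by have := List.length_pos_iff.2 hl; simp only [List.length_append]; omega) (p ++ q)
    (List.forall_mem_append.2 ⟨hσ.1.1, hσ.2⟩) rfl
  have hvisit' : visitedCosets M (p ++ l ++ q) ⊆ visitedCosets M (p ++ q) := by
    rw [visitedCosets_append_loop hlM, visitedCosets_append p q]
    exact Set.union_subset_union_left _ hvisit
  have hp : (p.prod : H ⧸ M) ∈ visitedCosets M β :=
    hsub (visitedCosets_append_left_subset _ _ ⟨p.length, by simp⟩)
  refine ⟨β, hβ, hvisit'.trans hsub, _,
    mul_mem (cosetConj_mem_loopSubmonoid hp ⟨hσ.1.2, hlen⟩ hlM) hz, ?_⟩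
  rw [prod_insert_loop p q hlM, hprod, Subgroup.coe_mul, mul_assoc]

/-- Inserting a loop into a word keeps the visited cosets, so that further loops can be
inserted. -/
theorem exists_prod_eq_of_mem_loopSubmonoid {A : Set H} {β : List H} (hβ : ∀ x ∈ β, x ∈ A)
    {z : M} (hz : z ∈ loopSubmonoid A (visitedCosets M β)) :
    ∃ σ : List H, (∀ x ∈ σ, x ∈ A) ∧ visitedCosets M β ⊆ visitedCosets M σ ∧
      σ.prod = z * β.prod := by
  induction hz using Submonoid.closure_induction_left with
  | one => exact ⟨β, hβ, subset_rfl, by simp⟩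
  | mul_left x hx z _ ih =>
    obtain ⟨c, hc, ⟨_, hlM⟩, ⟨l, hl, rfl⟩, rfl⟩ := hx
    obtain ⟨σ, hσ, hsub, hprod⟩ := ih
    obtain ⟨i, rfl⟩ := hsub hc
    refine ⟨σ.take i ++ l ++ σ.drop i, ?_, hsub.trans ?_, ?_⟩
    · simp only [List.forall_mem_append]
      exact ⟨⟨fun x hx => hσ x (List.mem_of_mem_take hx), hl.1⟩,
        fun x hx => hσ x (List.mem_of_mem_drop hx)⟩
    · rw [visitedCosets_append_loop hlM, ← List.take_append_drop i σ, visitedCosets_append]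
      simp only [List.take_append_drop]
      exact Set.union_subset_union_left _ (visitedCosets_append_left_subset _ _)
    · rw [prod_insert_loop _ _ hlM, List.take_append_drop, hprod, Subgroup.coe_mul, mul_assoc]

theorem mem_closure_iff_exists_boundedWords [M.FiniteIndex] {A : Set H} {h : H} :
    h ∈ Submonoid.closure A ↔ ∃ β ∈ boundedWords A (M.index * M.index),
      ∃ z ∈ loopSubmonoid A (visitedCosets M β), h = z * β.prod := by
  constructor
  · intro hh
    obtain ⟨σ, hσ, rfl⟩ := Submonoid.exists_list_of_mem_closure hh
    obtain ⟨β, hβ, -, hz⟩ := exists_prod_eq_loop_mul_prod (M := M) σ hσ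
    exact ⟨β, hβ, hz⟩
  · rintro ⟨β, hβ, z, hz, rfl⟩
    obtain ⟨σ, hσ, -, hprod⟩ := exists_prod_eq_of_mem_loopSubmonoid hβ.1 hz
    exact hprod ▸ list_prod_mem fun x hx => Submonoid.subset_closure (hσ x hx)

end VirtuallyAbelian

section Affine

open scoped IsMulCommutative Pointwise

section Homomorphisms

variable {V H : Type*} [AddMonoid V] [Group H] {M : Subgroup H}

variable (M) in
/-- A map that is a homomorphism into the abelian subgroup `M` followed by a right translation. -/
def IsAffine (F : V → H) : Prop :=
  ∃ (f : V →+ Additive M) (h : H), ∀ v, F v = (f v).toMul * h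

theorem IsAffine.const (h : H) : IsAffine M fun _ : V => h :=
  ⟨0, h, fun _ => by simp⟩

theorem IsAffine.pow {x : H} (hx : x ∈ M) (e : V →+ ℕ) : IsAffine M fun v => x ^ e v :=
  ⟨(multiplesHom _ (.ofMul ⟨x, hx⟩)).comp e, 1, fun _ => by simp⟩

variable [M.Normal] [IsMulCommutative M]

theorem IsAffine.mul {F F' : V → H} (hF : IsAffine M F) (hF' : IsAffine M F') :
    IsAffine M fun v => F v * F' v := by
  obtain ⟨f, h, hF⟩ := hF
  obtain ⟨f', h', hF'⟩ := hF'
  refine ⟨f + (cosetConj M h).toMonoidHom.toAdditive.comp f', h * h', fun v => ?_⟩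
  calc F v * F' v = (f v).toMul * (h * (f' v).toMul) * h' := by simp only [hF, hF', mul_assoc]
    _ = (f v).toMul * (cosetConj M h (f' v).toMul * h) * h' := by rw [cosetConj_mul]
    _ = _ := by simp [mul_assoc]

theorem IsAffine.prod_ofFn {n : ℕ} {F : Fin n → V → H} (hF : ∀ i, IsAffine M (F i)) :
    IsAffine M fun v => (List.ofFn fun i => F i v).prod := by
  induction n with
  | zero => simpa only [List.ofFn_zero] using .const _
  | succ n ih =>
    simp only [List.ofFn_succ, List.prod_cons]
    exact (hF 0).mul (ih fun i => hF i.succ)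

end Homomorphisms

variable {V H : Type*} [AddCommMonoid V] [AddMonoid.FG V] [Group H] {M : Subgroup H}
  [IsMulCommutative M] {F : V → H}

theorem IsAffine.isSemilinearSet_preimage (hF : IsAffine M F) {L : Submonoid M} (hL : L.FG)
    (h : H) : IsSemilinearSet {v | ∃ z ∈ L, F v = z * h} := by
  obtain ⟨f, h₀, hF⟩ := hF
  simp only [hF, ← eq_mul_inv_iff_mul_eq, mul_assoc]
  by_cases hM : h * h₀⁻¹ ∈ M
  · convert! ((IsSemilinearSet.of_fg (Submonoid.fg_iff_add_fg _ |>.1 hL)).vadd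
      (Additive.ofMul (⟨h * h₀⁻¹, hM⟩ : M))).preimage f using 1
    ext v
    simp only [Set.mem_ofPred_eq, Set.mem_preimage, Set.mem_vadd_set]
    constructor
    · rintro ⟨z, hz, hv⟩
      refine ⟨.ofMul z, hz, Additive.toMul.injective (Subtype.ext ?_)⟩
      rw [hv]
      exact congrArg Subtype.val (mul_comm' _ z)
    · rintro ⟨z, hz, hv⟩
      refine ⟨z.toMul, hz, ?_⟩
      rw [← hv]
      exact congrArg Subtype.val (mul_comm' _ z.toMul)
  · convert! IsSemilinearSet.empty using 1
    refine Set.eq_empty_of_forall_notMem fun v ⟨z, _, hz⟩ => hM ?_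
    exact (M.mul_mem_cancel_left z.2).1 (hz ▸ SetLike.coe_mem _)

theorem IsAffine.isSemilinearSet_preimage_closure [M.Normal] [M.FiniteIndex] (hF : IsAffine M F)
    {A : Set H} (hA : A.Finite) : IsSemilinearSet {v | F v ∈ Submonoid.closure A} := by
  convert! IsSemilinearSet.biUnion (finite_boundedWords hA (M.index * M.index)) fun β _ =>
    hF.isSemilinearSet_preimage (fg_loopSubmonoid hA (visitedCosets M β)) β.prod using 1
  ext v
  simp only [Set.mem_iUnion, Set.mem_ofPred_eq, exists_prop]
  exact mem_closure_iff_exists_boundedWords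

end Affine

section Geodesics

variable {G : Type*} [Group G] {S : Set G}

theorem isGeodesic_iff {ω : S → ℕ} {σ : List S} :
    IsGeodesic ω σ ↔ ∀ τ : List S, eval τ = eval σ → weight ω σ ≤ weight ω τ := by
  have hne : {k | ∃ τ : List S, eval τ = eval σ ∧ weight ω τ = k}.Nonempty := ⟨_, σ, rfl, rfl⟩
  constructor
  · intro h τ hτ
    exact h.trans_le (Nat.sInf_le ⟨τ, hτ, rfl⟩)
  · intro h
    obtain ⟨τ, hτ, hmin⟩ := Nat.sInf_mem hne
    exact le_antisymm ((h τ hτ).trans_eq hmin) (Nat.sInf_le ⟨σ, rfl, rfl⟩)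

/-- The element of `G × ℤ` made of the element represented by a word and the weight of the
word. -/
def weightedEval (ω : S → ℕ) (σ : List S) : G × Multiplicative ℤ :=
  (σ.map fun s : S => ((s : G), Multiplicative.ofAdd (ω s : ℤ))).prod

theorem weightedEval_eq (ω : S → ℕ) (σ : List S) :
    weightedEval ω σ = (eval σ, .ofAdd (weight ω σ : ℤ)) := by
  induction σ with
  | nil => rfl
  | cons s σ ih => simp_all [weightedEval, eval, weight]

theorem weightedEval_append (ω : S → ℕ) (σ τ : List S) :
    weightedEval ω (σ ++ τ) = weightedEval ω σ * weightedEval ω τ := by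
  rw [weightedEval, List.map_append, List.prod_append, ← weightedEval, ← weightedEval]

theorem weightedEval_flatten (ω : S → ℕ) (L : List (List S)) :
    weightedEval ω L.flatten = (L.map (weightedEval ω)).prod := by
  simp only [weightedEval, List.map_flatten, List.prod_flatten, List.map_map, Function.comp_def]
  rfl

/-- Generators of the epigraph of the weighted length in `G × ℤ`: the letters with their weights
reach its lower boundary, and `(1, 1)` moves up from there. -/
def epigraphGenerators (ω : S → ℕ) : Set (G × Multiplicative ℤ) :=
  insert (1, .ofAdd 1) (Set.range fun s : S => ((s : G), .ofAdd (ω s : ℤ)))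

theorem finite_epigraphGenerators (hS : S.Finite) (ω : S → ℕ) : (epigraphGenerators ω).Finite :=
  have : Finite S := hS
  (Set.finite_range _).insert _

theorem mem_closure_epigraphGenerators_iff {ω : S → ℕ} {g : G} {k : ℤ} :
    (g, .ofAdd k) ∈ Submonoid.closure (epigraphGenerators ω) ↔
      ∃ τ : List S, eval τ = g ∧ weight ω τ ≤ k := by
  constructor
  · suffices ∀ x ∈ Submonoid.closure (epigraphGenerators ω),
        ∃ τ : List S, eval τ = x.1 ∧ weight ω τ ≤ x.2.toAdd from this _
    intro x hx
    induction hx using Submonoid.closure_induction with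
    | one => exact ⟨[], rfl, le_rfl⟩
    | mem x hx =>
      obtain rfl | ⟨s, rfl⟩ := hx
      · exact ⟨[], rfl, zero_le_one⟩
      · exact ⟨[s], by simp [eval], by simp [weight]⟩
    | mul x x' _ _ ih ih' =>
      obtain ⟨τ, hτ, hle⟩ := ih
      obtain ⟨τ', hτ', hle'⟩ := ih'
      refine ⟨τ ++ τ', by simp [eval, ← hτ, ← hτ'], ?_⟩
      simpa [weight] using add_le_add hle hle'
  · rintro ⟨τ, rfl, hk⟩
    obtain ⟨n, rfl⟩ := Int.le.dest hk
    have hsplit : (eval τ, Multiplicative.ofAdd (weight ω τ + n : ℤ)) =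
        weightedEval ω τ * (1, .ofAdd 1) ^ n := by
      simp [weightedEval_eq, ← ofAdd_nsmul, ofAdd_add]
    rw [hsplit]
    refine mul_mem (list_prod_mem ?_) (pow_mem (Submonoid.subset_closure (.inl rfl)) n)
    simp only [List.mem_map]
    rintro _ ⟨s, -, rfl⟩
    exact Submonoid.subset_closure (.inr ⟨s, rfl⟩)

theorem isGeodesic_iff_notMem_closure {ω : S → ℕ} {σ : List S} :
    IsGeodesic ω σ ↔
      weightedEval ω σ * (1, .ofAdd (-1)) ∉ Submonoid.closure (epigraphGenerators ω) := by
  have hpred : weightedEval ω σ * (1, .ofAdd (-1)) = (eval σ, .ofAdd (weight ω σ - 1 : ℤ)) := by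
    simp [weightedEval_eq, sub_eq_add_neg, ofAdd_add]
  rw [hpred, mem_closure_epigraphGenerators_iff, isGeodesic_iff]
  push Not
  simp only [Int.sub_one_lt_iff, Nat.cast_le]

variable {N : Subgroup G}

instance isMulCommutative_prod {G' : Type*} [Group G'] {N' : Subgroup G'} [IsMulCommutative N]
    [IsMulCommutative N'] : IsMulCommutative (N.prod N') :=
  .of_comm fun x y => Subtype.ext (Prod.ext
    (congrArg Subtype.val (mul_comm' (⟨x.1.1, x.2.1⟩ : N) ⟨y.1.1, y.2.1⟩))
    (congrArg Subtype.val (mul_comm' (⟨x.1.2, x.2.2⟩ : N') ⟨y.1.2, y.2.2⟩)))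

instance finiteIndex_prod {G' : Type*} [Group G'] {N' : Subgroup G'} [N.FiniteIndex]
    [N'.FiniteIndex] : (N.prod N').FiniteIndex :=
  ⟨by simpa using ⟨Subgroup.FiniteIndex.index_ne_zero, Subgroup.FiniteIndex.index_ne_zero⟩⟩

variable [N.Normal] [IsMulCommutative N] {V : Type*} [AddMonoid V] {m : ℕ}

theorem isAffine_weightedEval_powerWord (ω : S → ℕ) (y : Fin m ≃ wordsY S N)
    (e : Fin m → V →+ ℕ) :
    IsAffine (N.prod (⊤ : Subgroup (Multiplicative ℤ)))
      fun v => weightedEval ω (powerWord y fun i => e i v) := by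
  simp only [powerWord, weightedEval_flatten, List.map_ofFn, Function.comp_def, List.map_replicate,
    List.prod_replicate]
  refine .prod_ofFn fun i => .pow ?_ (e i)
  rw [weightedEval_eq]
  exact ⟨(y i).2.2.2, trivial⟩

theorem isAffine_weightedEval_patternedWord (ω : S → ℕ) (y : Fin m ≃ wordsY S N)
    (π : List (wordsP S N)) :
    IsAffine (N.prod (⊤ : Subgroup (Multiplicative ℤ)))
      fun v => weightedEval ω (patternedWord y π v) := by
  have hblock (j : Fin (π.length + 1)) : IsAffine (N.prod ⊤)
      fun v : Fin ((π.length + 1) * m) → ℕ => weightedEval ω (powerWord y (block v j)) :=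
    isAffine_weightedEval_powerWord ω y fun i =>
      Pi.evalAddMonoidHom (fun _ => ℕ) (finProdFinEquiv (j, i))
  simp only [patternedWord, weightedEval_append, weightedEval_flatten, List.map_ofFn,
    Function.comp_def]
  exact (hblock 0).mul (.prod_ofFn fun j => (IsAffine.const _).mul (hblock j.succ))

theorem isSemilinearSet_setOf_isGeodesic [N.FiniteIndex] (hS : S.Finite) (ω : S → ℕ)
    (y : Fin m ≃ wordsY S N) (π : List (wordsP S N)) :
    IsSemilinearSet {v | IsGeodesic ω (patternedWord y π v)} := by
  have haffine := (isAffine_weightedEval_patternedWord ω y π).mul (.const (1, .ofAdd (-1)))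
  simpa only [Set.compl_ofPred, isGeodesic_iff_notMem_closure] using
    (haffine.isSemilinearSet_preimage_closure (finite_epigraphGenerators hS ω)).compl

end Geodesics

end VirtAb

theorem mainTheorem5_general {G : Type*} [Group G] (S : Set G) (hSfin : S.Finite) (ω : S → ℕ)
    (N : Subgroup G) [N.Normal] [N.FiniteIndex] [IsMulCommutative N]
    (m : ℕ) (y : Fin m ≃ VirtAb.wordsY S N) (π : List (VirtAb.wordsP S N)) :
    ∃ 𝒢 : Set (Fin ((π.length + 1) * m) → ℤ),
      VirtAb.IsPolyhedral 𝒢 ∧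
      𝒢 ⊆ VirtAb.natVectors ((π.length + 1) * m) ∧
      ∀ v : Fin ((π.length + 1) * m) → ℕ,
        (fun i => (v i : ℤ)) ∈ 𝒢 ↔
          VirtAb.IsGeodesic ω (VirtAb.patternedWord y π v) :=
  VirtAb.exists_isPolyhedral_natCast_mem_iff (VirtAb.isSemilinearSet_setOf_isGeodesic hSfin ω y π)

theorem mainTheorem5 {G : Type*} [Group G]
    -- the finite weighted monoid generating set
    (S : Set G) (hSfin : S.Finite) (hSgen : Submonoid.closure S = ⊤)
    (ω : S → ℕ) (hω : ∀ s, 0 < ω s)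
    -- the finite-index normal subgroup isomorphic to `ℤ^n` and its coset representatives
    (n : ℕ) (N : Subgroup G) [N.Normal] [N.FiniteIndex]
    (hN : Nonempty (N ≃* Multiplicative (Fin n → ℤ)))
    (T : Set G) (hT : Subgroup.IsComplement (N : Set G) T) (hT1 : (1 : G) ∈ T)
    -- the labelling of `Y`
    (m : ℕ) (y : Fin m ≃ VirtAb.wordsY S N)
    (π : List (VirtAb.wordsP S N)) (hπ : VirtAb.IsPattern hT π) :
    ∃ 𝒢 : Set (Fin ((π.length + 1) * m) → ℤ),
      VirtAb.IsPolyhedral 𝒢 ∧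
      𝒢 ⊆ VirtAb.natVectors ((π.length + 1) * m) ∧
      ∀ v : Fin ((π.length + 1) * m) → ℕ,
        (fun i => (v i : ℤ)) ∈ 𝒢 ↔
          VirtAb.IsGeodesic ω (VirtAb.patternedWord y π v) := by
  obtain ⟨φ⟩ := hN
  have : IsMulCommutative N :=
    .of_comm fun a b => φ.injective (by rw [map_mul, map_mul, mul_comm])
  exact mainTheorem5_general S hSfin ω N m y π
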